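/- Let $\mathcal S$ be a block algebra, i.e. a $C^*$-algebra isomorphic to $\mathrm{Mat}_s(\mathbb C)$ for some integer $s>0$. Let $\mathcal H$ be the Hilbert space with orthonormal basis $\{v(i_1\cdots i_k)\}$ indexed by all finite sequences of positive integers, including the empty one (Boltzmann–Fock space). Write $\phi(A)=(v(\emptyset),A\,v(\emptyset))$ for $A\in B(\mathcal H)$ (inner product linear on the right), and let $\phi_{\mathcal S}:B(\mathcal H)\otimes\mathcal S\to\mathcal S$ be the linear map with $\phi_{\mathcal S}(x\otimes y)=\phi(x)y$. For $\ell\ge 1$ let $\Sigma_\ell\in B(\mathcal H)$ be the isometry with $\Sigma_\ell v(i_1\cdots i_k)=v(\ell\, i_1\cdots i_k)$, and put $\Xi_\ell=\mathrm i^{\ell}\Sigma_\ell+\mathrm i^{-\ell}\Sigma_\ell^*$. Let $L=\sum_{\ell\ge1}\mathbf X_\ell\otimes a_\ell\in\mathbb C\langle\mathbf X\rangle\otimes\mathcal S$ be an $\mathcal S$-linear form, where $\mathbb C\langle\mathbf X\rangle$ is the noncommutative polynomial algebra in $\mathbf X_1,\mathbf X_2,\dots$ and $a_\ell\in\mathcal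 S$ vanishes for all but finitely many $\ell$. Put $L(\Xi)=\sum_\ell\Xi_\ell\otimes a_\ell\in B(\mathcal H)\otimes\mathcal S$, $\Phi_L(\zeta)=\sum_\ell a_\ell\zeta a_\ell$ for $\zeta\in\mathcal S$, $$\mathcal D_L=\{\Lambda\in\mathcal S : L(\Xi)-1_{B(\mathcal H)}\otimes\Lambda\ \text{is invertible in}\ B(\mathcal H)\otimes\mathcal S\},$$ $$G_L(\Lambda)=\phi_{\mathcal S}\bigl((L(\Xi)-1_{B(\mathcal H)}\otimes\Lambda)^{-1}\bigr)\qquad(\Lambda\in\mathcal D_L).$$ Then $G_L:\mathcal D_L\to\mathcal S$ is a solution of the Schwinger–Dyson equation with covariance map $\Phi_L$: the set $\mathcal D_L$ is nonempty and open in $\mathcal S$, the function $G_L$ is analytic on $\mathcal D_L$, and $$1_{\mathcal S}+\bigl(\Lambda+\Phi_L(G_L(\Lambda))\bigr)G_L(\Lambda)=0\qquad\text{for all }\Lambda\in\mathcal D_L .$$ -/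

import Mathlib

open scoped TensorProduct

namespace SchwingerDyson

noncomputable section

/-- A block algebra: a (unital) C⋆-algebra isomorphic to `Mat_s(ℂ)` for some integer `s > 0`. -/
def IsBlockAlgebra (S : Type*) [CStarAlgebra S] : Prop :=
  ∃ s : ℕ, 0 < s ∧ Nonempty (S ≃⋆ₐ[ℂ] Matrix (Fin s) (Fin s) ℂ)

/-- Boltzmann–Fock space: the Hilbert space with orthonormal basis indexed by all finite
sequences of positive integers, including the empty one. -/
abbrev BF : Type := lp (fun _ : List ℕ+ => ℂ) 2

/-- The basis vector `v(i₁ ⋯ i_k)`. -/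
def v (w : List ℕ+) : BF := lp.single 2 w (1 : ℂ)

theorem orthonormal_v : Orthonormal ℂ v := by
  rw [orthonormal_iff_ite]
  intro i j
  simp only [v]
  rw [lp.inner_single_left, lp.single_apply]
  by_cases h : i = j
  · subst h; simp
  · simp [h]

theorem orthonormal_v_cons (i : ℕ+) : Orthonormal ℂ fun w : List ℕ+ => v (i :: w) :=
  orthonormal_v.comp _ (List.cons_injective)

/-- The bounded operators on Boltzmann–Fock space. -/
abbrev BH : Type := BF →L[ℂ] BF

/-- The vectorial state `φ(A) = (v(∅), A v(∅))` (inner product linear on the right). -/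
def phiBF : BH →ₗ[ℂ] ℂ where
  toFun A := inner ℂ (v []) (A (v []))
  map_add' A B := by simp
  map_smul' c A := by simp

/-- The raising operator `Σ_i`, the isometry with `Σ_i v(i₁ ⋯ i_k) = v(i i₁ ⋯ i_k)`
(see `raise_v`). -/
def raise (i : ℕ+) : BH :=
  (orthonormal_v_cons i).orthogonalFamily.linearIsometry.toContinuousLinearMap

theorem raise_v (i : ℕ+) (w : List ℕ+) : raise i (v w) = v (i :: w) := by
  simp [raise, v, OrthogonalFamily.linearIsometry_apply_single]

/-- The semicircular variables `Ξ_ℓ = i^ℓ Σ_ℓ + i^{-ℓ} Σ_ℓ^*`. -/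
def Xi (l : ℕ+) : BH :=
  Complex.I ^ ((l : ℕ) : ℤ) • raise l
    + Complex.I ^ (-((l : ℕ) : ℤ)) • ContinuousLinearMap.adjoint (raise l)

section

variable (S : Type*) [CStarAlgebra S]

/-- An `S`-linear form: an element of `ℂ⟨X⟩ ⊗ S` together with its Hamel expansion
`∑_ℓ X_ℓ ⊗ a_ℓ`, all but finitely many Hamel coefficients `a_ℓ` being zero. -/
structure LinearForm where
  /-- The underlying element of `ℂ⟨X⟩ ⊗ S`. -/
  val : FreeAlgebra ℂ ℕ+ ⊗[ℂ] S
  /-- The Hamel coefficients. -/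
  coeff : ℕ+ →₀ S
  val_eq : val = coeff.sum fun l a => FreeAlgebra.ι ℂ l ⊗ₜ[ℂ] a

/-- The `S`-linear extension `φ_S : B(H) ⊗ S → S`, `x ⊗ y ↦ φ(x) y`, of the state `φ`. -/
def phiS : BH ⊗[ℂ] S →ₗ[ℂ] S :=
  (TensorProduct.lid ℂ S).toLinearMap ∘ₗ LinearMap.rTensor S phiBF

theorem phiS_tmul (x : BH) (y : S) : phiS S (x ⊗ₜ[ℂ] y) = phiBF x • y := by
  simp [phiS]

end

section

variable {S : Type*} [CStarAlgebra S]

/-- Evaluation `L(ξ)` of `L` at a sequence `ξ` in an algebra, by substituting `ξ_ℓ` for `X_ℓ`. -/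
def LinearForm.eval (L : LinearForm S) {A : Type*} [Ring A] [Algebra ℂ A] (x : ℕ+ → A) :
    A ⊗[ℂ] S :=
  Algebra.TensorProduct.map (FreeAlgebra.lift ℂ x) (AlgHom.id ℂ S) L.val

theorem LinearForm.eval_eq (L : LinearForm S) {A : Type*} [Ring A] [Algebra ℂ A] (x : ℕ+ → A) :
    L.eval x = L.coeff.sum fun l a => x l ⊗ₜ[ℂ] a := by
  simp [LinearForm.eval, L.val_eq, Finsupp.sum, map_sum]

/-- The covariance map `Φ_L(ζ) = ∑ a_ℓ ζ a_ℓ`. -/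
def LinearForm.Phi (L : LinearForm S) : S →L[ℂ] S :=
  L.coeff.sum fun _ a => ContinuousLinearMap.mulLeftRight ℂ S a a

theorem LinearForm.Phi_apply (L : LinearForm S) (z : S) :
    L.Phi z = L.coeff.sum fun _ a => a * z * a := by
  simp [LinearForm.Phi, Finsupp.sum]

/-- The operator `L(Ξ) - 1 ⊗ Λ` in `B(H) ⊗ S`. As `S` is finite-dimensional for block algebras,
the C⋆-algebraic tensor product is the algebraic one. -/
def LinearForm.pencil (L : LinearForm S) (Λ : S) : BH ⊗[ℂ] S :=
  L.eval Xi - (1 : BH) ⊗ₜ[ℂ] Λ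

/-- The domain `D_L` of all `Λ` for which `L(Ξ) - 1 ⊗ Λ` is invertible. -/
def LinearForm.domain (L : LinearForm S) : Set S := {Λ | IsUnit (L.pencil Λ)}

/-- `G_L(Λ) = φ_S((L(Ξ) - 1 ⊗ Λ)⁻¹)`, meaningful for `Λ ∈ D_L`. -/
def LinearForm.G (L : LinearForm S) (Λ : S) : S := phiS S (Ring.inverse (L.pencil Λ))

/-- `G : D → S` is a solution of the Schwinger–Dyson equation with covariance map `Φ`:
`D` is a nonempty open set, `G` is analytic on `D`, and `1 + (Λ + Φ(G(Λ))) G(Λ) = 0` on `D`. -/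
structure IsSDSolution (Φ : S →L[ℂ] S) (D : Set S) (G : S → S) : Prop where
  nonempty : D.Nonempty
  isOpen : IsOpen D
  analytic : AnalyticOnNhd ℂ G D
  equation : ∀ Λ ∈ D, 1 + (Λ + Φ (G Λ)) * G Λ = 0

end

end

end SchwingerDyson

open scoped Matrix.Norms.Operator

namespace SchwingerDyson

noncomputable section

/-! ### Right creation operators on Boltzmann–Fock space -/

section Fock

/-! Let `r_j` append `j` on the right and let `p` project onto the vacuum. Left and right operations
interfere only at the vacuum: `[Ξ_l, r_j] = δ_{lj} i^{-l} p` (`Xi_mul_raiseRight`). With `R = (L(Ξ)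
- 1 ⊗ Λ)⁻¹` and `G = φ_S(R)` this gives `[r_j ⊗ 1, R] = i^{-j} R (p ⊗ a_j) R`. Under `φ_S` the term
with `r_j` on the left dies and `p` splits the state, so `φ_S(R (r_j ⊗ 1)) = -i^{-j} G a_j G`. As
`Ξ_l v(∅) = i^l r_l v(∅)`, it follows that `φ_S(R L(Ξ)) = -G Φ(G)`, and slicing `R (L(Ξ) - 1 ⊗ Λ) =
1` yields `1 + G (Λ + Φ(G)) = 0`. Finite dimensionality of `S` lets the factors be exchanged. The
topological claims are read off in the Banach algebra `Mat_s(B(H)) ≅ B(H) ⊗ S`. -/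

theorem inner_v_left (w : List ℕ+) (x : BF) : inner ℂ (v w) x = x w := by
  simp [v, lp.inner_single_left]

/-- Bounded operators on Boltzmann–Fock space agreeing on the basis vectors are equal. -/
theorem ext_v {A B : BH} (h : ∀ w, A (v w) = B (v w)) : A = B := by
  refine lp.ext_continuousLinearMap (ENNReal.ofNat_ne_top (n := nat_lit 2)) fun w => ?_
  ext1
  exact h w

theorem adjoint_raise_v_nil (i : ℕ+) : ContinuousLinearMap.adjoint (raise i) (v []) = 0 := by
  ext w
  rw [← inner_v_left, ContinuousLinearMap.adjoint_inner_right, raise_v,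
    orthonormal_iff_ite.1 orthonormal_v]
  simp

theorem adjoint_raise_v_cons (i j : ℕ+) (w : List ℕ+) :
    ContinuousLinearMap.adjoint (raise i) (v (j :: w)) = if i = j then v w else 0 := by
  ext u
  rw [← inner_v_left, ← inner_v_left, ContinuousLinearMap.adjoint_inner_right, raise_v,
    orthonormal_iff_ite.1 orthonormal_v]
  by_cases hij : i = j
  · simp [hij, orthonormal_iff_ite.1 orthonormal_v]
  · simp [hij]

theorem orthonormal_v_concat (j : ℕ+) : Orthonormal ℂ fun w : List ℕ+ => v (w ++ [j]) :=
  orthonormal_v.comp _ (List.append_left_injective [j])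

/-- The isometry appending a letter on the right, `v(i₁ ⋯ i_k) ↦ v(i₁ ⋯ i_k j)`. -/
def raiseRight (j : ℕ+) : BH :=
  (orthonormal_v_concat j).orthogonalFamily.linearIsometry.toContinuousLinearMap

theorem raiseRight_v (j : ℕ+) (w : List ℕ+) : raiseRight j (v w) = v (w ++ [j]) := by
  simp [raiseRight, v, OrthogonalFamily.linearIsometry_apply_single]

/-- The orthogonal projection onto the vacuum vector `v(∅)`. -/
def vacuumProj : BH := (innerSL ℂ (v [])).smulRight (v [])

theorem vacuumProj_apply (x : BF) : vacuumProj x = inner ℂ (v []) x • v [] := by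
  simp [vacuumProj]

theorem phiBF_apply (A : BH) : phiBF A = inner ℂ (v []) (A (v [])) := rfl

theorem phiBF_one : phiBF 1 = 1 := by
  simp [phiBF_apply, orthonormal_v.1 []]

theorem phiBF_mul_vacuumProj_mul (A B : BH) :
    phiBF (A * vacuumProj * B) = phiBF A * phiBF B := by
  simp [phiBF_apply, vacuumProj_apply, mul_comm]

/-- Appending on the right leaves the range orthogonal to the vacuum. -/
theorem phiBF_raiseRight_mul (j : ℕ+) (A : BH) : phiBF (raiseRight j * A) = 0 := by
  have h : ContinuousLinearMap.adjoint (raiseRight j) (v []) = 0 := by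
    ext w
    rw [← inner_v_left, ContinuousLinearMap.adjoint_inner_right, raiseRight_v,
      orthonormal_iff_ite.1 orthonormal_v]
    simp
  rw [phiBF_apply, mul_apply_eq_comp, ← ContinuousLinearMap.adjoint_inner_left, h,
    inner_zero_left]

/-- The annihilation part kills the vacuum, where left and right creation agree. -/
theorem phiBF_mul_Xi (A : BH) (l : ℕ+) :
    phiBF (A * Xi l) = Complex.I ^ ((l : ℕ) : ℤ) * phiBF (A * raiseRight l) := by
  simp [phiBF_apply, Xi, raise_v, raiseRight_v, adjoint_raise_v_nil]

/-- The semicircular variables commute with the right raising operators up to a multiple of the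
vacuum projection. -/
theorem Xi_mul_raiseRight (l j : ℕ+) :
    Xi l * raiseRight j = raiseRight j * Xi l +
      (if l = j then Complex.I ^ (-((l : ℕ) : ℤ)) else 0) • vacuumProj := by
  refine ext_v fun w => ?_
  -- Only on the empty word is the appended letter also the first one, hence removable by `Σ_l^*`.
  cases w with
  | nil =>
    by_cases h : l = j <;>
    simp [Xi, raise_v, raiseRight_v, adjoint_raise_v_nil, adjoint_raise_v_cons, vacuumProj_apply,
      orthonormal_v.1 [], h]
  | cons i w =>
    have h0 : vacuumProj (v (i :: w)) = 0 := by
      simp [vacuumProj_apply, orthonormal_iff_ite.1 orthonormal_v]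
    by_cases h : l = i <;>
    simp [Xi, raise_v, raiseRight_v, adjoint_raise_v_cons, h0, h, -ite_smul]

theorem continuous_phiBF : Continuous phiBF :=
  (innerSL ℂ (v [])).continuous.comp
    (ContinuousLinearMap.apply ℂ BF (v [])).continuous

/-- The vacuum state as a continuous linear functional. -/
def phiCLM : BH →L[ℂ] ℂ := ⟨phiBF, continuous_phiBF⟩

end Fock

/-! ### The algebraic Schwinger–Dyson identity -/

section Slice

variable {A S ι : Type*} [Ring A] [Algebra ℂ A] [Ring S] [Algebra ℂ S]

/-- The slice map `A ⊗ S → S`, `x ⊗ y ↦ φ(x) y`, of a linear functional `φ`. -/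
def slice (S : Type*) [Ring S] [Algebra ℂ S] (φ : A →ₗ[ℂ] ℂ) : A ⊗[ℂ] S →ₗ[ℂ] S :=
  (TensorProduct.lid ℂ S).toLinearMap ∘ₗ LinearMap.rTensor S φ

theorem slice_tmul (φ : A →ₗ[ℂ] ℂ) (x : A) (y : S) : slice S φ (x ⊗ₜ[ℂ] y) = φ x • y := by
  simp [slice]

theorem slice_one {φ : A →ₗ[ℂ] ℂ} (h : φ 1 = 1) : slice S φ 1 = 1 := by
  rw [Algebra.TensorProduct.one_def, slice_tmul, h, one_smul]

theorem slice_mul_one_tmul (φ : A →ₗ[ℂ] ℂ) (R : A ⊗[ℂ] S) (a : S) :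
    slice S φ (R * (1 : A) ⊗ₜ[ℂ] a) = slice S φ R * a := by
  induction R with
  | zero => simp
  | tmul x y => simp [slice_tmul]
  | add x y hx hy => simp only [add_mul, map_add, hx, hy]

theorem slice_mul_tmul {φ : A →ₗ[ℂ] ℂ} {x r : A} {c : ℂ}
    (h : ∀ y, φ (y * x) = c * φ (y * r)) (R : A ⊗[ℂ] S) (a : S) :
    slice S φ (R * x ⊗ₜ[ℂ] a) = c • (slice S φ (R * r ⊗ₜ[ℂ] 1) * a) := by
  induction R with
  | zero => simp
  | tmul x y => simp [slice_tmul, h, smul_smul]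
  | add x y hx hy => simp only [add_mul, map_add, hx, hy, smul_add]

theorem slice_tmul_mul_eq_zero {φ : A →ₗ[ℂ] ℂ} {r : A} (h : ∀ y, φ (r * y) = 0)
    (R : A ⊗[ℂ] S) : slice S φ (r ⊗ₜ[ℂ] 1 * R) = 0 := by
  induction R with
  | zero => simp
  | tmul x y => simp [slice_tmul, h]
  | add x y hx hy => simp only [mul_add, map_add, hx, hy, add_zero]

theorem slice_mul_tmul_mul {φ : A →ₗ[ℂ] ℂ} {p : A} (h : ∀ x y, φ (x * p * y) = φ x * φ y)
    (R T : A ⊗[ℂ] S) (a : S) :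
    slice S φ (R * p ⊗ₜ[ℂ] a * T) = slice S φ R * a * slice S φ T := by
  induction R with
  | zero => simp
  | tmul x y =>
    induction T with
    | zero => simp
    | tmul x' y' => simp [slice_tmul, h, smul_smul, mul_comm]
    | add x y hx hy => simp only [mul_add, map_add, hx, hy]
  | add x y hx hy => simp only [add_mul, map_add, hx, hy]

variable [DecidableEq ι] {x r : ι → A} {p : A} {c : ι → ℂ} {φ : A →ₗ[ℂ] ℂ}

theorem pencil_mul_tmul_one
    (hcomm : ∀ l j, x l * r j = r j * x l + (if l = j then (c l)⁻¹ else 0) • p)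
    (a : ι →₀ S) (Λ : S) (j : ι) :
    ((a.sum fun l b => x l ⊗ₜ[ℂ] b) - (1 : A) ⊗ₜ[ℂ] Λ) * r j ⊗ₜ[ℂ] 1 =
      r j ⊗ₜ[ℂ] 1 * ((a.sum fun l b => x l ⊗ₜ[ℂ] b) - (1 : A) ⊗ₜ[ℂ] Λ) +
        (c j)⁻¹ • p ⊗ₜ[ℂ] a j := by
  have key : (a.sum fun l b => x l ⊗ₜ[ℂ] b) * r j ⊗ₜ[ℂ] 1 =
      r j ⊗ₜ[ℂ] 1 * (a.sum fun l b => x l ⊗ₜ[ℂ] b) + (c j)⁻¹ • p ⊗ₜ[ℂ] a j := by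
    rw [Finsupp.sum, Finset.sum_mul, Finset.mul_sum]
    simp only [Algebra.TensorProduct.tmul_mul_tmul, hcomm, mul_one, one_mul,
      TensorProduct.add_tmul, Finset.sum_add_distrib]
    congr 1
    rw [Finset.sum_eq_single j]
    · simp [TensorProduct.smul_tmul']
    · intro l _ hl
      simp [hl]
    · intro hj
      simp [Finsupp.notMem_support_iff.1 hj]
  simp only [sub_mul, mul_sub, key, Algebra.TensorProduct.tmul_mul_tmul, one_mul, mul_one]
  abel

theorem slice_mul_tmul_one_of_commute_up_to {P R : A ⊗[ℂ] S} {r p : A} {c : ℂ} {a : S}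
    (hP : P * r ⊗ₜ[ℂ] 1 = r ⊗ₜ[ℂ] 1 * P + c • p ⊗ₜ[ℂ] a) (hl : R * P = 1) (hr : P * R = 1)
    (hzero : ∀ y, φ (r * y) = 0) (hp : ∀ x y, φ (x * p * y) = φ x * φ y) :
    slice S φ (R * r ⊗ₜ[ℂ] 1) = -(c • (slice S φ R * a * slice S φ R)) := by
  have comm : r ⊗ₜ[ℂ] 1 * R = R * r ⊗ₜ[ℂ] 1 + c • (R * p ⊗ₜ[ℂ] a * R) := by
    -- Sandwiching by `R` turns the commutator with `P` into the commutator with its inverse.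
    have := congrArg (fun x => R * x * R) hP
    simp only [mul_add, add_mul, ← mul_assoc, hl, one_mul, mul_smul_comm, smul_mul_assoc] at this
    rw [this, mul_assoc _ P R, hr, mul_one]
  have := congrArg (slice S φ) comm
  rw [slice_tmul_mul_eq_zero hzero, map_add, map_smul, slice_mul_tmul_mul hp] at this
  exact eq_neg_of_add_eq_zero_left this.symm

/-- The Schwinger–Dyson equation, with factors in the opposite order, for an operator pencil whose
coefficients `x l` commute up to a vacuum projection `p` with operators `r j` that agree with
`(c l)⁻¹ x l` on the vacuum. -/
theorem one_add_slice_inverse_mul (hone : φ 1 = 1) (hp : ∀ x y, φ (x * p * y) = φ x * φ y)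
    (hzero : ∀ j y, φ (r j * y) = 0) (hx : ∀ l y, φ (y * x l) = c l * φ (y * r l))
    (hcomm : ∀ l j, x l * r j = r j * x l + (if l = j then (c l)⁻¹ else 0) • p)
    (hc : ∀ l, c l ≠ 0) (a : ι →₀ S) (Λ : S)
    (h : IsUnit ((a.sum fun l b => x l ⊗ₜ[ℂ] b) - (1 : A) ⊗ₜ[ℂ] Λ)) {G : S}
    (hG : G = slice S φ (Ring.inverse ((a.sum fun l b => x l ⊗ₜ[ℂ] b) - (1 : A) ⊗ₜ[ℂ] Λ))) :
    1 + G * (Λ + a.sum fun _ b => b * G * b) = 0 := by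
  have hP := pencil_mul_tmul_one hcomm a Λ
  set X := a.sum fun l b => x l ⊗ₜ[ℂ] b with hX
  have hl := Ring.inverse_mul_cancel _ h
  have hr := Ring.mul_inverse_cancel _ h
  set R := Ring.inverse (X - (1 : A) ⊗ₜ[ℂ] Λ)
  have hsum : slice S φ (R * X) = -(G * a.sum fun _ b => b * G * b) := by
    rw [hX, Finsupp.sum, Finsupp.sum, Finset.mul_sum, Finset.mul_sum, map_sum,
      ← Finset.sum_neg_distrib]
    refine Finset.sum_congr rfl fun l _ => ?_
    rw [slice_mul_tmul (hx l), slice_mul_tmul_one_of_commute_up_to (hP l) hl hr (hzero l) hp,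
      neg_mul, smul_neg, smul_mul_assoc, smul_inv_smul₀ (hc l), ← hG]
    simp only [mul_assoc]
  have hphi := congrArg (slice S φ) hl
  rw [slice_one hone, mul_sub, map_sub, hsum, slice_mul_one_tmul, ← hG] at hphi
  rw [← hphi, mul_add]
  abel

end Slice

/-! ### Openness, analyticity and nonemptiness via matrices over `A` -/

section Resolvent

variable {A S : Type*} [NormedRing A] [NormedAlgebra ℂ A] [NormedRing S] [NormedAlgebra ℂ S]
  {s : ℕ}

theorem ringInverse_map {M N : Type*} [Ring M] [Ring N] [Algebra ℂ M] [Algebra ℂ N]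
    (E : M ≃ₐ[ℂ] N) (x : M) : Ring.inverse (E x) = E (Ring.inverse x) := by
  by_cases h : IsUnit x
  · obtain ⟨u, rfl⟩ := h
    rw [Ring.inverse_unit]
    exact Ring.inverse_unit (Units.map (E : M →* N) u)
  · rw [Ring.inverse_non_unit _ h, Ring.inverse_non_unit _ (by simpa using h), map_zero]

/-- The identification `A ⊗ S ≅ Mat_s(A)` induced by an isomorphism `S ≅ Mat_s(ℂ)`. -/
def tensorEquivMatrix (A : Type*) [NormedRing A] [NormedAlgebra ℂ A]
    (e : S ≃ₐ[ℂ] Matrix (Fin s) (Fin s) ℂ) : A ⊗[ℂ] S ≃ₐ[ℂ] Matrix (Fin s) (Fin s) A :=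
  (Algebra.TensorProduct.congr AlgEquiv.refl e).trans (matrixEquivTensor (Fin s) ℂ A).symm

theorem tensorEquivMatrix_tmul (e : S ≃ₐ[ℂ] Matrix (Fin s) (Fin s) ℂ) (x : A) (y : S) :
    tensorEquivMatrix A e (x ⊗ₜ[ℂ] y) = x • (e y).map (algebraMap ℂ A) := by
  simp [tensorEquivMatrix]

theorem slice_eq_symm_map (e : S ≃ₐ[ℂ] Matrix (Fin s) (Fin s) ℂ) (φ : A →ₗ[ℂ] ℂ)
    (R : A ⊗[ℂ] S) : slice S φ R = e.symm ((tensorEquivMatrix A e R).map φ) := by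
  rw [AlgEquiv.eq_symm_apply]
  induction R with
  | zero => ext; simp
  | tmul x y =>
    ext i j
    simp [slice_tmul, tensorEquivMatrix_tmul, Algebra.algebraMap_eq_smul_one, mul_comm]
  | add x y hx hy => ext i j; simp [hx, hy]

/-- The slice map in matrix coordinates, as a continuous linear map. -/
def sliceMatrix (e : S ≃ₐ[ℂ] Matrix (Fin s) (Fin s) ℂ) (φ : A →L[ℂ] ℂ) :
    Matrix (Fin s) (Fin s) A →L[ℂ] S where
  toLinearMap := e.symm.toLinearMap ∘ₗ (φ : A →ₗ[ℂ] ℂ).mapMatrix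
  cont := (LinearMap.continuous_of_finiteDimensional e.symm.toLinearMap).comp
    (continuous_id.matrix_map φ.continuous)

theorem sliceMatrix_tensorEquivMatrix (e : S ≃ₐ[ℂ] Matrix (Fin s) (Fin s) ℂ) (φ : A →L[ℂ] ℂ)
    (R : A ⊗[ℂ] S) : sliceMatrix e φ (tensorEquivMatrix A e R) = slice S φ R :=
  (slice_eq_symm_map e (φ : A →ₗ[ℂ] ℂ) R).symm

/-- `Λ ↦ 1 ⊗ Λ` in matrix coordinates, as a continuous linear map. -/
def constMatrix (A : Type*) [NormedRing A] [NormedAlgebra ℂ A] [FiniteDimensional ℂ S]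
    (e : S ≃ₐ[ℂ] Matrix (Fin s) (Fin s) ℂ) : S →L[ℂ] Matrix (Fin s) (Fin s) A :=
  ((tensorEquivMatrix A e).toLinearMap ∘ₗ TensorProduct.mk ℂ A S 1).toContinuousLinearMap

variable [FiniteDimensional ℂ S] (e : S ≃ₐ[ℂ] Matrix (Fin s) (Fin s) ℂ) (X : A ⊗[ℂ] S)

theorem tensorEquivMatrix_sub_one_tmul (Λ : S) :
    tensorEquivMatrix A e (X - (1 : A) ⊗ₜ[ℂ] Λ) =
      tensorEquivMatrix A e X - constMatrix A e Λ := by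
  simp [constMatrix]

theorem isUnit_sub_one_tmul_iff (Λ : S) : IsUnit (X - (1 : A) ⊗ₜ[ℂ] Λ) ↔
    IsUnit (tensorEquivMatrix A e X - constMatrix A e Λ) := by
  rw [← tensorEquivMatrix_sub_one_tmul]
  exact (MulEquiv.isUnit_map (tensorEquivMatrix A e)).symm

theorem slice_inverse_sub_one_tmul (φ : A →L[ℂ] ℂ) (Λ : S) :
    slice S φ (Ring.inverse (X - (1 : A) ⊗ₜ[ℂ] Λ)) =
      sliceMatrix e φ (Ring.inverse (tensorEquivMatrix A e X - constMatrix A e Λ)) := by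
  rw [← tensorEquivMatrix_sub_one_tmul, ringInverse_map, sliceMatrix_tensorEquivMatrix]

variable [CompleteSpace A]

instance completeSpace_matrix_linftyOp :
    @CompleteSpace (Matrix (Fin s) (Fin s) A) Matrix.linftyOpNormedRing.toUniformSpace :=
  inferInstanceAs (CompleteSpace (Fin s → Fin s → A))

include e

theorem isOpen_setOf_isUnit_sub_one_tmul : IsOpen {Λ : S | IsUnit (X - (1 : A) ⊗ₜ[ℂ] Λ)} := by
  simp only [isUnit_sub_one_tmul_iff e]
  exact Units.isOpen.preimage (continuous_const.sub (constMatrix A e).continuous)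

theorem analyticOnNhd_slice_inverse (φ : A →L[ℂ] ℂ) :
    AnalyticOnNhd ℂ (fun Λ : S => slice S φ (Ring.inverse (X - (1 : A) ⊗ₜ[ℂ] Λ)))
      {Λ | IsUnit (X - (1 : A) ⊗ₜ[ℂ] Λ)} := by
  intro Λ hΛ
  simp only [slice_inverse_sub_one_tmul e]
  have h := (isUnit_sub_one_tmul_iff e X Λ).1 hΛ
  refine ((sliceMatrix e φ).analyticAt _).comp ?_
  refine AnalyticAt.comp (g := Ring.inverse) (analyticAt_inverse (𝕜 := ℂ) h.unit) ?_
  exact analyticAt_const.sub ((constMatrix A e).analyticAt Λ)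

theorem exists_isUnit_sub_one_tmul : ∃ Λ : S, IsUnit (X - (1 : A) ⊗ₜ[ℂ] Λ) := by
  -- A scalar `Λ = k` beyond the spectral radius works; the factor `‖1‖` is needed because the unit
  -- need not have norm one.
  obtain ⟨k, hk⟩ := NormedField.exists_lt_norm ℂ
    (‖tensorEquivMatrix A e X‖ * ‖(1 : Matrix (Fin s) (Fin s) A)‖)
  refine ⟨algebraMap ℂ S k, (isUnit_sub_one_tmul_iff e X _).2 ?_⟩
  have hc : constMatrix A e (algebraMap ℂ S k) = algebraMap ℂ _ k := by
    change tensorEquivMatrix A e ((1 : A) ⊗ₜ[ℂ] algebraMap ℂ S k) = _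
    rw [Algebra.algebraMap_eq_smul_one, TensorProduct.tmul_smul,
      ← Algebra.TensorProduct.one_def, map_smul, map_one, Algebra.algebraMap_eq_smul_one]
  rw [hc, ← neg_sub, IsUnit.neg_iff]
  exact spectrum.mem_resolventSet_of_norm_lt_mul hk

end Resolvent

/-! ### Specialization to the semicircular variables -/

namespace LinearForm

variable {S : Type*} [CStarAlgebra S] (L : LinearForm S)

/-- The Schwinger–Dyson equation with the factors in the opposite order. -/
theorem one_add_G_mul {Λ : S} (h : Λ ∈ L.domain) : 1 + L.G Λ * (Λ + L.Phi (L.G Λ)) = 0 := by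
  have hp : L.pencil Λ = (L.coeff.sum fun l b => Xi l ⊗ₜ[ℂ] b) - (1 : BH) ⊗ₜ[ℂ] Λ := by
    rw [pencil, eval_eq]
  have hu : IsUnit (L.pencil Λ) := h
  have hG : L.G Λ = phiS S (Ring.inverse (L.pencil Λ)) := rfl
  rw [hp] at hu hG
  rw [L.Phi_apply]
  refine one_add_slice_inverse_mul (c := fun l : ℕ+ => Complex.I ^ ((l : ℕ) : ℤ)) phiBF_one
    phiBF_mul_vacuumProj_mul phiBF_raiseRight_mul (fun l y => phiBF_mul_Xi y l) ?_
    (fun l => zpow_ne_zero _ Complex.I_ne_zero) L.coeff Λ hu hG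
  intro l j
  rw [Xi_mul_raiseRight, zpow_neg]

end LinearForm

end

end SchwingerDyson

open SchwingerDyson in
theorem proposition5p2 {S : Type*} [CStarAlgebra S] (hS : SchwingerDyson.IsBlockAlgebra S)
    (L : SchwingerDyson.LinearForm S) :
    SchwingerDyson.IsSDSolution L.Phi L.domain L.G := by
  obtain ⟨s, -, ⟨e'⟩⟩ := hS
  let e : S ≃ₐ[ℂ] Matrix (Fin s) (Fin s) ℂ := e'.toAlgEquiv
  have : FiniteDimensional ℂ S := e.symm.toLinearEquiv.finiteDimensional
  refine ⟨exists_isUnit_sub_one_tmul e (L.eval Xi),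
    isOpen_setOf_isUnit_sub_one_tmul e (L.eval Xi),
    analyticOnNhd_slice_inverse e (L.eval Xi) phiCLM, fun Λ hΛ => ?_⟩
  have h := L.one_add_G_mul hΛ
  -- In matrices over `ℂ` a one-sided inverse is two-sided, which reverses the factors.
  have h1 : e (L.G Λ) * e (-(Λ + L.Phi (L.G Λ))) = 1 := by
    rw [← map_mul, mul_neg, neg_eq_of_add_eq_zero_left h, map_one]
  rw [mul_eq_one_comm, ← map_mul, map_eq_one_iff e e.injective, neg_mul] at h1
  rw [← h1, neg_add_cancel]
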